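/- For an element $g$ of a group $G$, let $t(g)$ be the set of all integers $n\ge 1$ for which there exist $x_1,\dots,x_n\in G$ with $$(x_1 g x_1^{-1})(x_2 g x_2^{-1})\cdots(x_n g x_n^{-1})=1 .$$ The element $g$ is called a generalized torsion element if $t(g)\neq\emptyset$, and its generalized torsion order is $\mathrm{gord}(g)=\min t(g)$, with $\mathrm{gord}(g)=\infty$ if $t(g)=\emptyset$. The strict generalized torsion order spectrum of $G$ is $$\mathrm{gord}^{*}(G)=\{\mathrm{gord}(g) : g \text{ is a generalized torsion element of } G \text{ of infinite order}\}.$$ **Theorem.** Let $G$ and $H$ be torsion-free groups (groups whose only element of finite order is the identity), and let $G\ast H$ be their free product. Then $$\mathrm{gord}^{*}(G\ast H)=\mathrm{gord}^{*}(G)\cup\mathrm{gord}^{*}(H).$$ -/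

import Mathlib

/-- A group is torsion-free if the identity is its only element of finite order. (For
noncommutative groups Mathlib's `IsMulTorsionFree` is stronger: it asks that every power map
`g ↦ g ^ n`, `n ≠ 0`, be injective.) -/
def TorsionFreeGroup (G : Type*) [Group G] : Prop :=
  ∀ g : G, IsOfFinOrder g → g = 1

/-- The generalized torsion equation spectrum `t(g)`: the positive integers `n` for which some
product of `n` conjugates `x₁ g x₁⁻¹ ⋯ xₙ g xₙ⁻¹` of `g` is the identity. -/
def genTorsionEqSpectrum {G : Type*} [Group G] (g : G) : Set ℕ :=
  {n | 0 < n ∧ ∃ x : Fin n → G, (List.ofFn fun i => x i * g * (x i)⁻¹).prod = 1}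

/-- `g` is a generalized torsion element if `t(g)` is nonempty. -/
def IsGenTorsion {G : Type*} [Group G] (g : G) : Prop :=
  (genTorsionEqSpectrum g).Nonempty

/-- The generalized torsion order `gord(g) = min t(g)`, which is `∞` if `t(g)` is empty. -/
noncomputable def gord {G : Type*} [Group G] (g : G) : ℕ∞ :=
  ⨅ n ∈ genTorsionEqSpectrum g, (n : ℕ∞)

/-- The strict generalized torsion order spectrum `gord*(G)`: the generalized torsion orders of
the generalized torsion elements of `G` that are not torsion elements. -/
def strictGordSpectrum (G : Type*) [Group G] : Set ℕ∞ :=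
  {m | ∃ g : G, ¬ IsOfFinOrder g ∧ IsGenTorsion g ∧ gord g = m}

/-! Both factors are retracts of `G ∗ H`, and homomorphisms only enlarge `t(g)`, so an element of a
factor has the same spectrum there as in the free product. It remains to show that an element not
conjugate into a factor is never a generalized torsion element. Such an element is conjugate to a
cyclically reduced word `W` of letters `(a, b)` with `a ≠ 1`, `b ≠ 1`.

Suppose a product of `n` conjugates of `W` is trivial. Topologically this gives a sphere with `n`
holes, each boundary curve reading `W`, cut into discs lying over `A` and discs lying over `B`. Its
Euler characteristic is `2 - n`. Combinatorially, the discs are the trivial cycles of `α` and of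
`α⁻¹ * s` on the set `X` of letters, and they meet along `|X|` arcs, so the Euler characteristic is
the number of discs minus `|X|`. Such data start from a disc with trivial boundary word; the bound
depends only on conjugacy classes of the words (`WordBound.of_conj`), and each cut producing a new
copy of `W` costs one (`WordBound.split`).

Conversely, for `n` copies of `W` the Euler characteristic is at most `-n`
(`EulerBound.le_of_isCopies`). Label letters by their position in `W`. A disc whose letters all have
the same position would make a power of a nontrivial element trivial, so by torsion-freeness each
disc has an ascent of position, and there are at most `|X| - n` ascents. Since `2 - n > -n`, this is
a contradiction. -/

open Equiv

/-! ### Trivial cycles of labelled permutations. -/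

/-- `σ` has at least `m` pairwise disjoint invariant subsets on which the labelling `a` is a
coboundary; equivalently, at least `m` cycles of `σ` along which the product of labels is `1`. -/
def HasTrivialCycles {X A : Type*} [Group A] (σ : Perm X) (a : X → A) (m : ℕ) : Prop :=
  ∃ (c : X → ℕ) (h : X → A) (I : Finset ℕ), (∀ x, c (σ x) = c x) ∧ (∀ i ∈ I, ∃ x, c x = i) ∧
    (∀ x, c x ∈ I → h (σ x) = h x * a x) ∧ m ≤ I.card

namespace HasTrivialCycles

variable {X Y A : Type*} [Group A]

theorem congr {σ : Perm X} {τ : Perm Y} {a : X → A} {b : Y → A} {m : ℕ} (e : X ≃ Y)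
    (hσ : ∀ x, e (σ x) = τ (e x)) (hab : ∀ x, b (e x) = a x) (h : HasTrivialCycles σ a m) :
    HasTrivialCycles τ b m := by
  obtain ⟨c, p, I, h1, h2, h3, h4⟩ := h
  have key : ∀ y, e.symm (τ y) = σ (e.symm y) := fun y => by
    rw [symm_apply_eq, hσ, apply_symm_apply]
  refine ⟨c ∘ e.symm, p ∘ e.symm, I, fun y => ?_, fun i hi => ?_, fun y hy => ?_, h4⟩
  · simp [key, h1]
  · obtain ⟨x, rfl⟩ := h2 i hi
    exact ⟨e x, by simp⟩
  · have := h3 _ hy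
    simp only [Function.comp, key, this]
    rw [← hab, apply_symm_apply]

/-- A transposition with both points in one colour class of `c` spoils only that class. Between two
classes it joins cycles, and two trivial classes join to a trivial one, so again only one is lost.
-/
theorem mul_swap [DecidableEq X] {σ : Perm X} {a : X → A} {m : ℕ}
    (h : HasTrivialCycles σ a (m + 1)) (x y : X) : HasTrivialCycles (σ * swap x y) a m := by
  obtain ⟨c, p, I, h1, h2, h3, h4⟩ := h
  -- The colour `c y` will be discarded and its points recoloured `c x`. If `c x` stays in `I`, the
  -- potential must be valid on both classes.
  wlog hxy : c x ∈ I → c y ∈ I generalizing x y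
  · rw [swap_comm]
    exact this y x fun _ => by tauto
  have hσ : ∀ z, z ≠ x → z ≠ y → (σ * swap x y) z = σ z := fun z hx hy => by
    simp [swap_apply_of_ne_of_ne hx hy]
  have hx : (σ * swap x y) x = σ y := by simp
  have hy : (σ * swap x y) y = σ x := by simp
  have hI : m ≤ (I.erase (c y)).card := by
    have := I.pred_card_le_card_erase (a := c y)
    omega
  generalize σ * swap x y = τ at *
  by_cases hc : c x = c y
  · refine ⟨c, p, I.erase (c y), fun z => ?_, fun i hi => h2 i (Finset.mem_of_mem_erase hi),
      fun z hz => ?_, hI⟩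
    · by_cases hzx : z = x
      · rw [hzx, hx, h1, hc]
      by_cases hzy : z = y
      · rw [hzy, hy, h1, hc]
      rw [hσ z hzx hzy, h1]
    · rw [Finset.mem_erase] at hz
      rw [hσ z (by rintro rfl; exact hz.1 hc) (by rintro rfl; exact hz.1 rfl)]
      exact h3 z hz.2
  -- The left factor on the class of `y` makes the new potential at `σ y` equal to `p (σ x)`, as the
  -- new successors `x ↦ σ y`, `y ↦ σ x` require.
  · refine ⟨fun z => if c z = c y then c x else c z,
      fun z => if c z = c y then p (σ x) * (p (σ y))⁻¹ * p z else p z, I.erase (c y),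
      fun z => ?_, fun i hi => ?_, fun z hz => ?_, hI⟩
    · by_cases hzx : z = x
      · rw [hzx, hx]; simp [h1]
      by_cases hzy : z = y
      · rw [hzy, hy]; simp [h1]
      simp only [hσ z hzx hzy, h1]
    · rw [Finset.mem_erase] at hi
      obtain ⟨z, rfl⟩ := h2 i hi.2
      exact ⟨z, by simp [hi.1]⟩
    · by_cases hzx : z = x
      · subst hzx
        simp only [hc, if_false, Finset.mem_erase] at hz
        rw [hx]
        simp [h1, hc, h3 z hz.2]
      by_cases hzy : z = y
      · subst hzy
        simp only [if_true, Finset.mem_erase] at hz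
        rw [hy]
        have := h3 z (hxy hz.2)
        simp [h1, hc, this, mul_assoc]
      rw [hσ z hzx hzy]
      by_cases hzc : c z = c y
      · simp only [hzc, if_true, Finset.mem_erase] at hz
        simp [h1, hzc, h3 z (hzc ▸ hxy hz.2), mul_assoc]
      · simp only [hzc, if_false, Finset.mem_erase] at hz
        simp [h1, hzc, h3 z hz.2]

/-- Cutting a point with trivial label out of its cycle creates a new trivial cycle. -/
theorem swap_mul_isolate [Finite X] [DecidableEq X] {σ : Perm X} {a : X → A} {m : ℕ}
    (h : HasTrivialCycles σ a m) {x : X} (hx : σ x ≠ x) (ha : a x = 1) :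
    HasTrivialCycles (swap (σ x) x * σ) a (m + 1) := by
  obtain ⟨c, p, I, h1, h2, h3, h4⟩ := h
  -- A fresh colour for the isolated point `x`.
  obtain ⟨N, hN⟩ := (I.finite_toSet.union (Set.finite_range c)).infinite_compl.nonempty
  simp only [Set.mem_compl_iff, Set.mem_union, Finset.mem_coe, Set.mem_range, not_or,
    not_exists] at hN
  have hτx : (swap (σ x) x * σ) x = x := by simp
  have hτ : ∀ z, σ z = x → (swap (σ x) x * σ) z = σ x := fun z hz => by simp [hz]
  have hτ' : ∀ z, z ≠ x → σ z ≠ x → (swap (σ x) x * σ) z = σ z := fun z hz hz' => by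
    simp [swap_apply_of_ne_of_ne (σ.injective.ne hz) hz']
  generalize swap (σ x) x * σ = τ at *
  refine ⟨fun z => if z = x then N else c z, p, insert N I, fun z => ?_, fun i hi => ?_,
    fun z hz => ?_, ?_⟩
  · by_cases hz : z = x
    · subst hz; simp [hτx]
    by_cases hz' : σ z = x
    · rw [hτ z hz']
      simp [hx, hz, h1, ← h1 z, hz']
    · rw [hτ' z hz hz']
      simp [hz, hz', h1]
  · rcases Finset.mem_insert.1 hi with rfl | hi
    · exact ⟨x, by simp⟩
    · obtain ⟨z, rfl⟩ := h2 i hi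
      by_cases hz : z = x
      · subst hz; exact ⟨σ z, by simp [hx, h1]⟩
      · exact ⟨z, by simp [hz]⟩
  · by_cases hz' : z = x
    · subst hz'; simp [hτx, ha]
    simp only [hz', if_false, Finset.mem_insert] at hz
    have hN' : c z ∈ I := hz.resolve_left (hN.2 z)
    · by_cases hzx : σ z = x
      · rw [hτ z hzx, ← h3 z hN', hzx, h3 x (by rwa [← hzx, h1]), ha, mul_one]
      · rw [hτ' z hz' hzx, h3 z hN']
  · rw [Finset.card_insert_of_notMem hN.1]; omega

end HasTrivialCycles

/-! ### Inserting and deleting a point of a permutation. -/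

/-- Insert the point `none` into the cycle of `σ` through `q`, immediately before `q`. -/
def insertBefore {Y : Type*} [DecidableEq Y] (q : Y) (σ : Perm Y) : Perm (Option Y) :=
  swap none (some q) * optionCongr σ

section insertBefore

variable {Y A : Type*} [DecidableEq Y] [Group A] (q : Y) (σ : Perm Y)

@[simp] theorem insertBefore_none : insertBefore q σ none = some q := by simp [insertBefore]

theorem insertBefore_mul (τ : Perm Y) :
    insertBefore q (σ * τ) = insertBefore q σ * optionCongr τ := by
  ext1 (_ | y) <;> simp [insertBefore]

theorem insertBefore_some_of_eq {y : Y} (h : σ y = q) : insertBefore q σ (some y) = none := by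
  simp [insertBefore, h]

theorem insertBefore_some_of_ne {y : Y} (h : σ y ≠ q) :
    insertBefore q σ (some y) = some (σ y) := by
  simp [insertBefore, swap_apply_of_ne_of_ne, h]

namespace HasTrivialCycles

variable {q σ} {a : Option Y → A} {a' : Y → A} {m : ℕ}

theorem of_insertBefore (hq : a' q = a none * a (some q)) (ha : ∀ y, y ≠ q → a' y = a (some y))
    (h : HasTrivialCycles (insertBefore q σ) a m) : HasTrivialCycles σ a' m := by
  obtain ⟨c, p, I, h1, h2, h3, h4⟩ := h
  have hcq : c (some q) = c none := by rw [← h1 none]; simp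
  have hpq : c (some q) ∈ I → p (some q) = p none * a none := fun h => by
    rw [← h3 none (hcq ▸ h)]; simp
  have hc : ∀ y, c (some (σ y)) = c (some y) := fun y => by
    by_cases hy : σ y = q
    · rw [← h1 (some y), insertBefore_some_of_eq _ _ hy, hy, hcq]
    · rw [← h1 (some y), insertBefore_some_of_ne _ _ hy]
  refine ⟨fun y => c (some y), fun y => if y = q then p none else p (some y), I, hc,
    fun i hi => ?_, fun y hy => ?_, h4⟩
  · obtain ⟨_ | y, rfl⟩ := h2 i hi
    · exact ⟨q, hcq⟩
    · exact ⟨y, rfl⟩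
  · have h5 : (if σ y = q then p none else p (some (σ y))) = p (some y) * a (some y) := by
      rw [← h3 _ hy]
      split_ifs with h
      · rw [insertBefore_some_of_eq _ _ h]
      · rw [insertBefore_some_of_ne _ _ h]
    simp only [h5]
    split_ifs with h
    · subst h
      rw [hq, hpq hy, mul_assoc]
    · rw [ha y h]

theorem insertBefore (hq : a' q = a none * a (some q)) (ha : ∀ y, y ≠ q → a' y = a (some y))
    (h : HasTrivialCycles σ a' m) : HasTrivialCycles (insertBefore q σ) a m := by
  obtain ⟨c, p, I, h1, h2, h3, h4⟩ := h
  refine ⟨fun y => y.elim (c q) c,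
    fun y => y.elim (p q) fun y => if y = q then p q * a none else p y, I, ?_,
    fun i hi => ?_, ?_, h4⟩
  · rintro (_ | y)
    · simp
    · by_cases hy : σ y = q
      · rw [insertBefore_some_of_eq _ _ hy]
        simp [← h1 y, hy]
      · rw [insertBefore_some_of_ne _ _ hy]
        simp [h1]
  · obtain ⟨y, rfl⟩ := h2 i hi
    exact ⟨some y, rfl⟩
  · rintro (_ | y) hy
    · simp
    · have h5 : (if y = q then p q * a none else p y) * a (some y) = p (σ y) := by
        rw [h3 y hy]
        split_ifs with h
        · rw [h, hq, mul_assoc]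
        · rw [ha y h]
      by_cases hy : σ y = q
      · rw [insertBefore_some_of_eq _ _ hy]
        simp [h5, hy]
      · rw [insertBefore_some_of_ne _ _ hy]
        simp [h5, hy]

-- Deleting the fixed point `none` loses at most its own colour.
omit [DecidableEq Y] in
theorem of_optionCongr (h : HasTrivialCycles (optionCongr σ) a (m + 1)) :
    HasTrivialCycles σ (fun y => a (some y)) m := by
  obtain ⟨c, p, I, h1, h2, h3, h4⟩ := h
  refine ⟨fun y => c (some y), fun y => p (some y), I.erase (c none), fun y => h1 (some y),
    fun i hi => ?_, fun y hy => h3 (some y) (Finset.mem_of_mem_erase hy), ?_⟩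
  · rw [Finset.mem_erase] at hi
    obtain ⟨_ | y, rfl⟩ := h2 i hi.2
    · exact absurd rfl hi.1
    · exact ⟨y, rfl⟩
  · have := I.pred_card_le_card_erase (a := c none)
    omega

omit [DecidableEq Y] in
theorem optionCongr (ha : a none = 1) (h : HasTrivialCycles σ (fun y => a (some y)) m) :
    HasTrivialCycles (optionCongr σ) a (m + 1) := by
  obtain ⟨c, p, I, h1, h2, h3, h4⟩ := h
  refine ⟨fun y => y.elim 0 fun y => c y + 1, fun y => y.elim 1 p,
    insert 0 (I.map ⟨Nat.succ, Nat.succ_injective⟩), ?_, ?_, ?_, ?_⟩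
  · rintro (_ | y) <;> simp [h1]
  · intro i hi
    rcases Finset.mem_insert.1 hi with rfl | hi
    · exact ⟨none, rfl⟩
    · obtain ⟨j, hj, rfl⟩ := Finset.mem_map.1 hi
      obtain ⟨y, rfl⟩ := h2 j hj
      exact ⟨some y, rfl⟩
  · rintro (_ | y) hy
    · simp [ha]
    · simp at hy
      simp [h3 y hy]
  · rw [Finset.card_insert_of_notMem (by simp), Finset.card_map]
    omega

end HasTrivialCycles

end insertBefore

/-! ### Euler characteristic of surfaces built from discs. -/

/-- A lower bound `χ` for the largest Euler characteristic of a surface assembled from discs with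
boundary in `A` and discs with boundary in `B`, whose boundary spells the cyclic words with
letters `a x`, `b x`, `x ∈ X`, and successor permutation `s`. -/
def EulerBound {X A B : Type*} [Fintype X] [Group A] [Group B] (s : Perm X) (a : X → A)
    (b : X → B) (χ : ℤ) : Prop :=
  ∃ (α : Perm X) (m k : ℕ), HasTrivialCycles α a m ∧ HasTrivialCycles (α⁻¹ * s) b k ∧
    χ + Fintype.card X ≤ m + k

namespace EulerBound

variable {X Y A B : Type*} [Fintype X] [Fintype Y] [Group A] [Group B]

theorem congr {s : Perm X} {t : Perm Y} {a : X → A} {b : X → B} {a' : Y → A} {b' : Y → B}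
    {χ : ℤ} (e : X ≃ Y) (hs : ∀ x, e (s x) = t (e x)) (ha : ∀ x, a' (e x) = a x)
    (hb : ∀ x, b' (e x) = b x) (h : EulerBound s a b χ) : EulerBound t a' b' χ := by
  obtain ⟨α, m, k, h1, h2, h3⟩ := h
  refine ⟨(e.symm.trans α).trans e, m, k, h1.congr e (fun x => by simp) ha,
    h2.congr e (fun x => ?_) hb, by rwa [← Fintype.card_congr e]⟩
  simp only [Perm.mul_apply, ← hs]
  rw [Perm.eq_inv_iff_eq]
  simp

/-- With `α` kept fixed, only `α⁻¹ * s` changes, and it changes by the transposition. -/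
theorem mul_swap [DecidableEq X] {s : Perm X} {a : X → A} {b : X → B} {χ : ℤ}
    (h : EulerBound s a b χ) (x y : X) : EulerBound (s * swap x y) a b (χ - 1) := by
  obtain ⟨α, m, k, h1, h2, h3⟩ := h
  cases k with
  | zero => exact ⟨α, m, 0, h1, ⟨fun _ => 0, 1, ∅, by simp⟩, by push_cast at *; omega⟩
  | succ k =>
    refine ⟨α, m, k, h1, ?_, by push_cast at *; omega⟩
    rw [← mul_assoc]
    exact h2.mul_swap x y

/-- The roles of the two factors are symmetric. -/
theorem symm {s : Perm X} {a : X → A} {b : X → B} {χ : ℤ} (h : EulerBound s a b χ) :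
    EulerBound s b (a ∘ s) χ := by
  obtain ⟨α, m, k, h1, h2, h3⟩ := h
  -- The complementary permutation becomes `s⁻¹ * α * s`, a conjugate of `α`; this is why each `b x`
  -- is paired with the next letter's `a (s x)`.
  refine ⟨α⁻¹ * s, k, m, h2, h1.congr s⁻¹ (fun x => by simp) (fun x => by simp), by omega⟩

variable [DecidableEq Y] {q : Y} {s : Perm Y} {a : Option Y → A} {b : Option Y → B} {a' : Y → A}
  {χ : ℤ}

/-- Deleting a letter lowers the number of arcs by one, so one disc may be given up. Once `none` is
a fixed point of `α⁻¹ * s`, it is a `B`-disc that can be removed. -/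
theorem of_insertBefore (hb : b none = 1) (hq : a' q = a none * a (some q))
    (ha : ∀ y, y ≠ q → a' y = a (some y)) (h : EulerBound (insertBefore q s) a b χ) :
    EulerBound s a' (fun y => b (some y)) χ := by
  obtain ⟨α, m, k, h1, h2, h3⟩ := h
  rw [Fintype.card_option] at h3
  obtain ⟨α, m, k, h1, h2, h3, h4⟩ : ∃ (α : Perm (Option Y)) (m k : ℕ), HasTrivialCycles α a m ∧
      HasTrivialCycles (α⁻¹ * insertBefore q s) b k ∧ χ + Fintype.card Y + 1 ≤ m + k ∧
      (α⁻¹ * insertBefore q s) none = none := by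
    by_cases h : (α⁻¹ * insertBefore q s) none = none
    · exact ⟨α, m, k, h1, h2, by push_cast at h3; omega, h⟩
    -- This change of `α` isolates `none` on the `B` side, gaining a disc there and losing at most
    -- one on the `A` side.
    refine ⟨α * swap ((α⁻¹ * insertBefore q s) none) none, m - 1, k + 1, ?_, ?_, ?_, ?_⟩
    · cases m with
      | zero => exact ⟨fun _ => 0, 1, ∅, by simp⟩
      | succ m => exact h1.mul_swap _ _
    · simpa [mul_assoc] using h2.swap_mul_isolate h hb
    · push_cast at *; omega
    · simp
  obtain ⟨β, hβ⟩ : ∃ β : Perm Y, α⁻¹ * insertBefore q s = optionCongr β :=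
    ⟨removeNone _, by rw [map_equiv_removeNone, h4, swap_self]; rfl⟩
  have hα : α = insertBefore q (s * β⁻¹) := by
    rw [insertBefore_mul, eq_mul_inv_iff_mul_eq.2
      (show α * optionCongr β = _ by rw [← hβ, mul_inv_cancel_left]),
      show (optionCongr β)⁻¹ = optionCongr β⁻¹ from rfl]
  rw [hβ] at h2
  refine ⟨s * β⁻¹, m, k - 1, (hα ▸ h1).of_insertBefore hq ha, ?_, by push_cast at *; omega⟩
  cases k with
  | zero => exact ⟨fun _ => 0, 1, ∅, by simp⟩
  | succ k => simpa using h2.of_optionCongr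

theorem insertBefore (hb : b none = 1) (hq : a' q = a none * a (some q))
    (ha : ∀ y, y ≠ q → a' y = a (some y)) (h : EulerBound s a' (fun y => b (some y)) χ) :
    EulerBound (insertBefore q s) a b χ := by
  obtain ⟨α, m, k, h1, h2, h3⟩ := h
  refine ⟨_root_.insertBefore q α, m, k + 1, h1.insertBefore hq ha, ?_, ?_⟩
  · have : (_root_.insertBefore q α)⁻¹ * _root_.insertBefore q s = optionCongr (α⁻¹ * s) := by
      rw [inv_mul_eq_iff_eq_mul, ← insertBefore_mul, mul_inv_cancel_left]
    rw [this]
    exact h2.optionCongr hb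
  · rw [Fintype.card_option]
    push_cast
    omega

end EulerBound

namespace EulerBound

section

variable {Y A B : Type*} [Fintype Y] [Group A] [Group B]

theorem of_symm {s : Perm Y} {a : Y → A} {b : Y → B} {χ : ℤ} (h : EulerBound s b (a ∘ s) χ) :
    EulerBound s a b χ :=
  h.symm.congr s (fun _ => rfl) (fun _ => rfl) (fun _ => rfl)

variable [DecidableEq Y] {q : Y} {s : Perm Y} {a : Option Y → A} {b : Option Y → B} {a' : Y → A}
  {b' : Y → B} {χ : ℤ}

omit [Fintype Y] [Group A] in
theorem comp_insertBefore (hq' : a' q = a none) (ha : ∀ y, y ≠ q → a' y = a (some y)) :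
    (fun y => (a ∘ _root_.insertBefore q s) (some y)) = a' ∘ s := by
  ext y
  by_cases hy : s y = q
  · simp [insertBefore_some_of_eq _ _ hy, hy, hq']
  · simp [insertBefore_some_of_ne _ _ hy, ha _ hy]

/-- After `symm` each `b` is followed by the next `a`, so this is the merge of `A`-letters with the
factors exchanged. -/
theorem of_insertBefore_right (ha1 : a (some q) = 1) (hq : b' q = b none * b (some q))
    (hb : ∀ y, y ≠ q → b' y = b (some y)) (hq' : a' q = a none)
    (ha : ∀ y, y ≠ q → a' y = a (some y)) (h : EulerBound (_root_.insertBefore q s) a b χ) :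
    EulerBound s a' b' χ := by
  have := h.symm.of_insertBefore (by simpa using ha1) hq hb
  rw [comp_insertBefore hq' ha] at this
  exact this.of_symm

theorem insertBefore_right (ha1 : a (some q) = 1) (hq : b' q = b none * b (some q))
    (hb : ∀ y, y ≠ q → b' y = b (some y)) (hq' : a' q = a none)
    (ha : ∀ y, y ≠ q → a' y = a (some y)) (h : EulerBound s a' b' χ) :
    EulerBound (_root_.insertBefore q s) a b χ := by
  refine of_symm (EulerBound.insertBefore (a' := b') (by simpa using ha1) hq hb ?_)
  rw [comp_insertBefore hq' ha]
  exact h.symm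

end

end EulerBound

/-! ### Cyclic words: rotation, merging of letters, cutting. -/

/-- `EulerBound` for the cyclic word `D` together with a further family of cyclic words,
indexed by `Z`. -/
def WordBound {Z A B : Type*} [Fintype Z] [Group A] [Group B] (s : Perm Z) (f : Z → A × B)
    (D : List (A × B)) (χ : ℤ) : Prop :=
  EulerBound (X := Fin D.length ⊕ Z) (Perm.sumCongr (finRotate D.length) s)
    (fun x => (Sum.elim D.get f x).1) (fun x => (Sum.elim D.get f x).2) χ

/-- Split off the first letter of a word. -/
def finSuccSumEquiv (n : ℕ) (Z : Type*) : Fin (n + 1) ⊕ Z ≃ Option (Fin n ⊕ Z) where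
  toFun := Sum.elim (Fin.cases none (some ∘ Sum.inl)) (some ∘ Sum.inr)
  invFun x := x.elim (Sum.inl 0) (Sum.map Fin.succ id)
  left_inv := by
    rintro (i | z)
    · cases i using Fin.cases <;> simp
    · simp
  right_inv := by rintro (_ | _ | _) <;> simp

theorem finSuccSumEquiv_sumCongr {Z : Type*} [DecidableEq Z] (n : ℕ) (s : Perm Z)
    (x : Fin (n + 2) ⊕ Z) :
    finSuccSumEquiv (n + 1) Z (Perm.sumCongr (finRotate (n + 2)) s x) =
      insertBefore (Sum.inl 0) (Perm.sumCongr (finRotate (n + 1)) s)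
        (finSuccSumEquiv (n + 1) Z x) := by
  rcases x with i | z
  · cases i using Fin.cases with
    | zero =>
      have : (1 : Fin (n + 2)) = Fin.succ 0 := rfl
      simp only [finSuccSumEquiv, coe_fn_mk, Sum.elim_inl, Fin.cases_zero, insertBefore_none,
        Perm.sumCongr_apply, Sum.map_inl, finRotate_apply_zero, this, Fin.cases_succ,
        Function.comp]
    | succ i =>
      by_cases hi : i = Fin.last n
      · subst hi
        simp only [finSuccSumEquiv, coe_fn_mk, Sum.elim_inl, Fin.cases_succ, Function.comp,
          Perm.sumCongr_apply, Sum.map_inl]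
        rw [insertBefore_some_of_eq _ _ (by simp)]
        rw [show (Fin.last n).succ = Fin.last (n + 1) from rfl, finRotate_last]
        rfl
      · have h1 : finRotate (n + 2) i.succ = (finRotate (n + 1) i).succ := by
          ext
          have h2 : i.succ ≠ Fin.last (n + 1) := fun h => hi (Fin.succ_injective _ h)
          rw [Fin.val_succ, coe_finRotate_of_ne_last hi, coe_finRotate_of_ne_last h2, Fin.val_succ]
        simp only [finSuccSumEquiv, coe_fn_mk, Sum.elim_inl, Fin.cases_succ, Function.comp,
          Perm.sumCongr_apply, Sum.map_inl, h1]
        rw [insertBefore_some_of_ne]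
        · simp
        · have := coe_finRotate_of_ne_last hi
          simp only [Perm.sumCongr_apply, Sum.map_inl, ne_eq, Sum.inl.injEq]
          intro h
          rw [h] at this
          simp at this
  · simp only [finSuccSumEquiv, coe_fn_mk, Perm.sumCongr_apply, Sum.map_inr, Sum.elim_inr,
      Function.comp]
    rw [insertBefore_some_of_ne] <;> simp

namespace WordBound

variable {Z A B : Type*} [Fintype Z] [Group A] [Group B] {s : Perm Z} {f : Z → A × B}
  {D : List (A × B)} {χ : ℤ}

theorem rotate_one (d : A × B) (h : WordBound s f (d :: D) χ) : WordBound s f (D ++ [d]) χ := by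
  have hlen : (d :: D).length = (D ++ [d]).length := by simp
  let e := (finRotate (d :: D).length).symm.trans (finCongr hlen)
  have hf : ∀ x : Fin (D.length + 1), (D ++ [d]).get (e x) = (d :: D).get x := by
    intro x
    obtain ⟨y, rfl⟩ := (finRotate (D.length + 1)).surjective x
    have : e (finRotate (D.length + 1) y) = finCongr hlen y := by simp [e]
    rw [this]
    cases y using Fin.lastCases with
    | last => rw [finRotate_last]; simp
    | cast y =>
      have : finRotate (D.length + 1) y.castSucc = y.succ := by
        ext; rw [coe_finRotate_of_ne_last (Fin.castSucc_lt_last y).ne]; simp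
      rw [this]; simp
  have hrot : ∀ {m n : ℕ} (h : m = n) (x : Fin m),
      finCongr h (finRotate m x) = finRotate n (finCongr h x) := by rintro m _ rfl x; rfl
  refine EulerBound.congr (sumCongr e (Equiv.refl Z)) ?_ ?_ ?_ h
  · rintro (x | z)
    · simp only [Perm.sumCongr_apply, Sum.map_inl, sumCongr_apply]
      congr 1
      simp only [e, trans_apply, ← hrot, symm_apply_apply, apply_symm_apply]
    · simp
  · rintro (x | z)
    · exact congrArg Prod.fst (hf x)
    · simp
  · rintro (x | z)
    · exact congrArg Prod.snd (hf x)
    · simp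

theorem append_comm (E : List (A × B)) (h : WordBound s f (E ++ D) χ) :
    WordBound s f (D ++ E) χ := by
  induction E generalizing D with
  | nil => simpa using h
  | cons d E ih =>
    have := ih (by simpa using h.rotate_one (D := E ++ D) d)
    simpa using this

theorem merge_left_iff (x y : A) (b : B) :
    WordBound s f ((x, 1) :: (y, b) :: D) χ ↔ WordBound s f ((x * y, b) :: D) χ := by
  classical
  constructor
  · intro h
    have := EulerBound.congr (finSuccSumEquiv (D.length + 1) Z)
      (a' := fun z => (z.elim (x, 1) (Sum.elim ((y, b) :: D).get f)).1)
      (b' := fun z => (z.elim (x, 1) (Sum.elim ((y, b) :: D).get f)).2)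
      (finSuccSumEquiv_sumCongr D.length s) ?_ ?_ h
    · refine (EulerBound.of_insertBefore (a' := fun z => (Sum.elim ((x * y, b) :: D).get f z).1)
        rfl rfl ?_ this).congr (Equiv.refl _) (fun _ => rfl) (fun _ => rfl) ?_
      · rintro (i | z) hz
        · cases i using Fin.cases with
          | zero => exact absurd rfl hz
          | succ i => rfl
        · rfl
      · rintro (i | z)
        · cases i using Fin.cases <;> rfl
        · rfl
    all_goals
      rintro (i | z)
      · cases i using Fin.cases <;> rfl
      · rfl
  · intro h
    have := EulerBound.insertBefore (q := Sum.inl 0)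
      (a := fun z => (z.elim (x, 1) (Sum.elim ((y, b) :: D).get f)).1)
      (b := fun z => (z.elim (x, 1) (Sum.elim ((y, b) :: D).get f)).2)
      (a' := fun z => (Sum.elim ((x * y, b) :: D).get f z).1) rfl rfl ?_
      (EulerBound.congr (s := Perm.sumCongr (finRotate (D.length + 1)) s)
        (t := Perm.sumCongr (finRotate (D.length + 1)) s)
        (a := fun z => (Sum.elim ((x * y, b) :: D).get f z).1)
        (Equiv.refl _) (fun _ => rfl) (fun _ => rfl) ?_ h)
    · refine this.congr (finSuccSumEquiv (D.length + 1) Z).symm ?_ ?_ ?_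
      · intro z
        rw [symm_apply_eq]
        exact ((finSuccSumEquiv_sumCongr _ _ _).trans (by rw [apply_symm_apply])).symm
      all_goals rintro (_ | _ | _) <;> rfl
    · rintro (i | z) hz
      · cases i using Fin.cases with
        | zero => exact absurd rfl hz
        | succ i => rfl
      · rfl
    · rintro (i | z)
      · cases i using Fin.cases <;> rfl
      · rfl

theorem merge_right_iff (a : A) (x y : B) :
    WordBound s f ((a, x) :: (1, y) :: D) χ ↔ WordBound s f ((a, x * y) :: D) χ := by
  classical
  have hne : ∀ z : Fin (D.length + 1) ⊕ Z, z ≠ Sum.inl 0 →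
      Sum.elim ((a, x * y) :: D).get f z = Sum.elim ((1, y) :: D).get f z := by
    rintro (i | z) hz
    · cases i using Fin.cases with
      | zero => exact absurd rfl hz
      | succ i => rfl
    · rfl
  constructor
  · intro h
    have := EulerBound.congr (finSuccSumEquiv (D.length + 1) Z)
      (a' := fun z => (z.elim (a, x) (Sum.elim ((1, y) :: D).get f)).1)
      (b' := fun z => (z.elim (a, x) (Sum.elim ((1, y) :: D).get f)).2)
      (finSuccSumEquiv_sumCongr D.length s) ?_ ?_ h
    · exact EulerBound.of_insertBefore_right rfl rfl (fun z hz => congrArg Prod.snd (hne z hz))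
        rfl (fun z hz => congrArg Prod.fst (hne z hz)) this
    all_goals
      rintro (i | z)
      · cases i using Fin.cases <;> rfl
      · rfl
  · intro h
    have := EulerBound.insertBefore_right (q := Sum.inl 0)
      (a := fun z => (z.elim (a, x) (Sum.elim ((1, y) :: D).get f)).1)
      (b := fun z => (z.elim (a, x) (Sum.elim ((1, y) :: D).get f)).2)
      rfl rfl (fun z hz => congrArg Prod.snd (hne z hz))
      rfl (fun z hz => congrArg Prod.fst (hne z hz)) h
    refine this.congr (finSuccSumEquiv (D.length + 1) Z).symm ?_ ?_ ?_
    · intro z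
      rw [symm_apply_eq]
      exact ((finSuccSumEquiv_sumCongr _ _ _).trans (by rw [apply_symm_apply]; rfl)).symm
    all_goals rintro (_ | _ | _) <;> rfl

/-- Cutting a cyclic word into two costs at most one. -/
theorem split (E : List (A × B)) (hE : E ≠ []) (hD : D ≠ []) (h : WordBound s f (E ++ D) χ) :
    WordBound (Perm.sumCongr (finRotate E.length) s) (Sum.elim E.get f) D (χ - 1) := by
  classical
  obtain ⟨m, hm⟩ : ∃ m, E.length = m + 1 := Nat.exists_eq_succ_of_ne_zero (by simpa)
  obtain ⟨n, hn⟩ : ∃ n, D.length = n + 1 := Nat.exists_eq_succ_of_ne_zero (by simpa)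
  have hlen : E.length + D.length = (E ++ D).length := by simp
  let e : Fin E.length ⊕ Fin D.length ≃ Fin (E ++ D).length :=
    finSumFinEquiv.trans (finCongr hlen)
  let e' : Fin D.length ⊕ (Fin E.length ⊕ Z) ≃ Fin (E ++ D).length ⊕ Z :=
    (sumAssoc _ _ _).symm.trans (sumCongr ((sumComm _ _).trans e) (Equiv.refl Z))
  -- The transposed positions are the last letters of `D` and of `E`; exchanging their successors
  -- closes up each word separately.
  have h1 := h.mul_swap (e' (Sum.inl ⟨n, by omega⟩)) (e' (Sum.inr (Sum.inl ⟨m, by omega⟩)))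
  have hf : ∀ x, Sum.elim (E ++ D).get f (e' x) = Sum.elim D.get (Sum.elim E.get f) x := by
    rintro (i | i | z)
    · simp [e', e]
    · simp [e', e]
    · simp [e']
  have hrot : ∀ (k : ℕ) (i : Fin k), (finRotate k i : ℕ) = if (i : ℕ) + 1 = k then 0 else (i : ℕ) + 1 := by
    intro k i
    cases k with
    | zero => exact i.elim0
    | succ k => rw [coe_finRotate]; simp [Fin.ext_iff]
  refine h1.congr e'.symm (fun x => ?_) (fun x => ?_) (fun x => ?_)
  · obtain ⟨x, rfl⟩ := e'.surjective x
    rw [symm_apply_apply, symm_apply_eq]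
    have hinl : ∀ i : Fin D.length, e' (Sum.inl i) = Sum.inl ⟨E.length + i, by simp⟩ :=
      fun i => by simp [e', e, Fin.ext_iff]
    have hinr : ∀ i : Fin E.length, e' (Sum.inr (Sum.inl i)) = Sum.inl ⟨i, by simp; omega⟩ :=
      fun i => by simp [e', e, Fin.ext_iff]
    rw [Perm.mul_apply, e'.injective.swap_apply]
    rcases x with i | i | z
    · by_cases hi : (i : ℕ) = n
      · have : i = ⟨n, by omega⟩ := Fin.ext hi
        rw [← this, swap_apply_left]
        simp only [hinr, hinl, Perm.sumCongr_apply, Sum.map_inl, Sum.inl.injEq, Fin.ext_iff, hrot]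
        simp; grind
      · rw [swap_apply_of_ne_of_ne (by simp [Fin.ext_iff, hi]) (by simp)]
        simp only [hinl, Perm.sumCongr_apply, Sum.map_inl, Sum.inl.injEq, Fin.ext_iff, hrot]
        simp; grind
    · by_cases hi : (i : ℕ) = m
      · have : i = ⟨m, by omega⟩ := Fin.ext hi
        rw [← this, swap_apply_right]
        simp only [hinr, hinl, Perm.sumCongr_apply, Sum.map_inl, Sum.map_inr, Sum.inl.injEq,
          Fin.ext_iff, hrot]
        simp; grind
      · rw [swap_apply_of_ne_of_ne (by simp) (by simp [Fin.ext_iff, hi])]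
        simp only [hinr, Perm.sumCongr_apply, Sum.map_inl, Sum.map_inr, Sum.inl.injEq,
          Fin.ext_iff, hrot]
        simp; grind
    · rw [swap_apply_of_ne_of_ne (by simp) (by simp)]
      simp [e']
  all_goals
    obtain ⟨x, rfl⟩ := e'.surjective x
    rw [hf, symm_apply_apply]

end WordBound

/-! ### The upper bound for copies of a reduced word. -/

/-- If the labels depend only on a level and are not torsion, then every trivial cycle contains
an ascent of the level. -/
theorem HasTrivialCycles.le_card_ascents {X A : Type*} [Fintype X] [Group A]
    (hA : TorsionFreeGroup A) {α : Perm X} {a : X → A} {m L : ℕ} (lev : X → Fin L)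
    (g : Fin L → A) (ha : ∀ x, a x = g (lev x)) (hg : ∀ i, g i ≠ 1)
    (h : HasTrivialCycles α a m) :
    m ≤ (Finset.univ.filter fun x => lev x < lev (α x)).card := by
  obtain ⟨c, p, I, h1, h2, h3, h4⟩ := h
  have key : ∀ i ∈ I, ∃ x, c x = i ∧ lev x < lev (α x) := by
    intro i hi
    by_contra! hcon
    -- Without ascents the level stays minimal along the orbit of `x`, so each step multiplies the
    -- potential by the same `g (lev x)`. Returning to `x` makes this element torsion.
    obtain ⟨x, hx, hmin⟩ := Set.exists_min_image {x | c x = i} lev (Set.toFinite _) (h2 i hi)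
    have hit : ∀ j : ℕ, c ((α ^ j) x) = i ∧ lev ((α ^ j) x) = lev x ∧
        p ((α ^ j) x) = p x * g (lev x) ^ j := by
      intro j
      induction j with
      | zero => exact ⟨hx, by simp⟩
      | succ j ih =>
        obtain ⟨hc, hl, hp⟩ := ih
        rw [pow_succ', Perm.mul_apply]
        have hc' : c (α ((α ^ j) x)) = i := by rw [h1, hc]
        exact ⟨hc', le_antisymm (hl ▸ hcon _ hc) (hmin _ hc'),
          by rw [h3 _ (hc ▸ hi), hp, ha, hl, pow_succ, mul_assoc]⟩
    have := (hit (orderOf α)).2.2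
    rw [pow_orderOf_eq_one, Perm.one_apply, left_eq_mul] at this
    exact hg _ (hA _ (isOfFinOrder_iff_pow_eq_one.2 ⟨_, orderOf_pos α, this⟩))
  choose y hy using key
  rw [← Finset.card_attach] at h4
  refine h4.trans (Finset.card_le_card_of_injOn (fun i => y i.1 i.2)
    (fun i _ => by simp [(hy i.1 i.2).2]) ?_)
  intro i _ j _ hij
  ext
  rw [← (hy i.1 i.2).1, ← (hy j.1 j.2).1]
  exact congrArg c hij

/-- The family of cyclic words given by `s` and `f` consists of `k` copies of `W`. -/
def IsCopies {Z P : Type*} [Fintype Z] (W : List P) (s : Perm Z) (f : Z → P) (k : ℕ) : Prop :=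
  ∃ lev : Z → Fin W.length, (∀ z, f z = W.get (lev z)) ∧
    (∀ z, lev (s z) = finRotate W.length (lev z)) ∧
    (Finset.univ.filter fun z => (lev z : ℕ) = 0).card = k

theorem IsCopies.succ {Z P : Type*} [Fintype Z] {W : List P} (hW : W ≠ []) {s : Perm Z}
    {f : Z → P} {k : ℕ} (h : IsCopies W s f k) :
    IsCopies W (Perm.sumCongr (finRotate W.length) s) (Sum.elim W.get f) (k + 1) := by
  obtain ⟨lev, h1, h2, h3⟩ := h
  refine ⟨Sum.elim id lev, ?_, ?_, ?_⟩
  · rintro (i | z) <;> simp [h1]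
  · rintro (i | z) <;> simp [h2]
  · obtain ⟨m, hm⟩ : ∃ m, W.length = m + 1 := Nat.exists_eq_succ_of_ne_zero (by simpa)
    have h0 : (Finset.univ.filter fun i : Fin W.length => (i : ℕ) = 0).card = 1 :=
      Finset.card_eq_one.2 ⟨⟨0, by omega⟩, by ext; simp [Fin.ext_iff]⟩
    rw [← h3, ← h0, Finset.card_filter, Finset.card_filter, Finset.card_filter,
      Fintype.sum_sum_type, add_comm]
    rfl

/-- Ascents of `α` and of `α⁻¹ * s` are both indexed by their targets `y = α x`, `y = s x`: they say
that `lev (α⁻¹ y)` lies below `lev y`, respectively above `lev (s⁻¹ y)`. -/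
theorem EulerBound.le_of_isCopies {X A B : Type*} [Fintype X] [Group A] [Group B]
    (hA : TorsionFreeGroup A) (hB : TorsionFreeGroup B) {W : List (A × B)}
    (hW : ∀ p ∈ W, p.1 ≠ 1 ∧ p.2 ≠ 1) {s : Perm X} {f : X → A × B} {k : ℕ} {χ : ℤ}
    (hc : IsCopies W s f k) (h : EulerBound s (fun x => (f x).1) (fun x => (f x).2) χ) :
    χ ≤ -k := by
  classical
  obtain ⟨lev, h1, h2, h3⟩ := hc
  obtain ⟨α, m, n, h4, h5, h6⟩ := h
  have h4 := h4.le_card_ascents hA lev (fun i => (W.get i).1) (fun x => by rw [h1])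
    fun i => (hW _ (List.get_mem _ _)).1
  have h5 := h5.le_card_ascents hB lev (fun i => (W.get i).2) (fun x => by rw [h1])
    fun i => (hW _ (List.get_mem _ _)).2
  have h7 : (Finset.univ.filter fun x => lev x < lev (α x)).card ≤
      (Finset.univ.filter fun y => lev (α⁻¹ y) < lev y).card :=
    Finset.card_le_card_of_injOn α (fun x hx => by
      rw [Finset.mem_coe, Finset.mem_filter] at hx ⊢
      exact ⟨Finset.mem_univ _, by simpa using hx.2⟩) α.injective.injOn
  have h8 : (Finset.univ.filter fun x => lev x < lev ((α⁻¹ * s) x)).card ≤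
      (Finset.univ.filter fun y => lev (s⁻¹ y) < lev (α⁻¹ y)).card :=
    Finset.card_le_card_of_injOn s (fun x hx => by
      rw [Finset.mem_coe, Finset.mem_filter] at hx ⊢
      exact ⟨Finset.mem_univ _, by simpa using hx.2⟩) s.injective.injOn
  have hrot : ∀ y, (lev y : ℕ) = if (lev (s⁻¹ y) : ℕ) + 1 = W.length then 0
      else (lev (s⁻¹ y) : ℕ) + 1 := by
    intro y
    have := h2 (s⁻¹ y)
    rw [show s (s⁻¹ y) = y from s.apply_symm_apply y] at this
    rw [this]
    generalize lev (s⁻¹ y) = i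
    generalize W.length = L at i
    cases L with
    | zero => exact i.elim0
    | succ k => rw [coe_finRotate]; simp [Fin.ext_iff]
  -- If `lev y ≠ 0`, then `lev y = lev (s⁻¹ y) + 1` leaves no room for `lev (α⁻¹ y)` strictly
  -- between. If `lev y = 0`, then `lev (s⁻¹ y)` is the top level and neither ascent occurs.
  have h9 : (Finset.univ.filter fun y => lev (α⁻¹ y) < lev y).card +
      (Finset.univ.filter fun y => lev (s⁻¹ y) < lev (α⁻¹ y)).card ≤
      (Finset.univ.filter fun z => ¬ (lev z : ℕ) = 0).card := by
    rw [← Finset.card_union_of_disjoint]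
    · refine Finset.card_le_card fun y hy => ?_
      simp only [Finset.mem_union, Finset.mem_filter, Finset.mem_univ, true_and,
        Fin.lt_def] at hy ⊢
      have := hrot y
      have := (lev (α⁻¹ y)).2
      grind
    · rw [Finset.disjoint_filter]
      intro y _ hy hy'
      rw [Fin.lt_def] at hy hy'
      have := hrot y
      grind
  have h10 := Finset.card_filter_add_card_filter_not (s := Finset.univ)
    (fun z => (lev z : ℕ) = 0)
  rw [Finset.card_univ] at h10
  omega

/-! ### Words as elements of the free product. -/

open Monoid

section Value

variable {A B : Type*} [Group A] [Group B]

/-- The element of the free product spelled by a word. -/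
def wordValue : FreeMonoid (A × B) →* Coprod A B :=
  FreeMonoid.lift fun p => Coprod.inl p.1 * Coprod.inr p.2

theorem wordValue_surjective : Function.Surjective (wordValue (A := A) (B := B)) := by
  intro g
  induction g using Coprod.induction_on with
  | inl a => exact ⟨FreeMonoid.of (a, 1), by simp [wordValue]⟩
  | inr b => exact ⟨FreeMonoid.of (1, b), by simp [wordValue]⟩
  | mul x y hx hy =>
    obtain ⟨u, rfl⟩ := hx
    obtain ⟨v, rfl⟩ := hy
    exact ⟨u * v, map_mul _ _ _⟩

theorem exists_wordValue_eq (g : Coprod A B) : ∃ D : List (A × B), D ≠ [] ∧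
    wordValue (FreeMonoid.ofList D) = g := by
  obtain ⟨D, rfl⟩ := wordValue_surjective g
  exact ⟨(1, 1) :: D.toList, by simp, by simp [wordValue, FreeMonoid.ofList_cons]⟩

variable {Z : Type*} [Fintype Z]

/-- Two words are congruent if replacing one by the other inside a longer cyclic word does not
affect `WordBound`. -/
def wordCon (s : Perm Z) (f : Z → A × B) : Con (FreeMonoid (A × B)) where
  -- The context `C` is nonempty because the empty list contributes no boundary curve, whereas `[(1,
  -- 1)]` contributes one.
  r D E := ∀ (χ : ℤ) (C : List (A × B)), C ≠ [] →
    (WordBound s f (C ++ D.toList) χ ↔ WordBound s f (C ++ E.toList) χ)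
  iseqv := ⟨fun _ _ _ _ => Iff.rfl, fun h χ C hC => (h χ C hC).symm,
    fun h h' χ C hC => (h χ C hC).trans (h' χ C hC)⟩
  mul' {D D' E E'} h h' χ C hC := by
    have hcomm : ∀ D E : List (A × B), WordBound s f (D ++ E) χ ↔ WordBound s f (E ++ D) χ :=
      fun D E => ⟨fun h => h.append_comm, fun h => h.append_comm⟩
    rw [FreeMonoid.toList_mul, FreeMonoid.toList_mul, ← List.append_assoc, hcomm,
      ← List.append_assoc, h χ _ (by simp [hC]), List.append_assoc, hcomm, h' χ _ (by simp [hC]),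
      List.append_assoc]

theorem WordBound.merge_one_iff {s : Perm Z} {f : Z → A × B} {D : List (A × B)} {χ : ℤ}
    (hD : D ≠ []) : WordBound s f ((1, 1) :: D) χ ↔ WordBound s f D χ := by
  obtain ⟨⟨a, b⟩, D, rfl⟩ := List.exists_cons_of_ne_nil hD
  rw [WordBound.merge_left_iff, one_mul]

/-- The merging rules map `A` and `B` homomorphically to the quotient by `wordCon`. By the universal
property of the free product, the quotient map factors through `wordValue`. -/
theorem wordCon_of_wordValue_eq (s : Perm Z) (f : Z → A × B) {D E : FreeMonoid (A × B)}
    (h : wordValue D = wordValue E) : wordCon s f D E := by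
  have hcomm : ∀ (D E : List (A × B)) (χ : ℤ),
      WordBound s f (D ++ E) χ ↔ WordBound s f (E ++ D) χ :=
    fun D E _ => ⟨fun h => h.append_comm, fun h => h.append_comm⟩
  have hone : wordCon s f (FreeMonoid.of (1, 1)) 1 := fun χ C hC => by
    rw [hcomm]
    simpa using WordBound.merge_one_iff hC
  let φ : A →* (wordCon s f).Quotient :=
    { toFun := fun a => (FreeMonoid.of (a, 1) : FreeMonoid (A × B))
      map_one' := (Con.eq _).2 hone
      map_mul' := fun x y => ((Con.eq _).2 fun χ C hC => by
        rw [hcomm, hcomm C]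
        exact (WordBound.merge_left_iff x y 1).symm) }
  let ψ : B →* (wordCon s f).Quotient :=
    { toFun := fun b => (FreeMonoid.of (1, b) : FreeMonoid (A × B))
      map_one' := (Con.eq _).2 hone
      map_mul' := fun x y => ((Con.eq _).2 fun χ C hC => by
        rw [hcomm, hcomm C]
        exact (WordBound.merge_right_iff 1 x y).symm) }
  have hlift : (Coprod.lift φ ψ).comp wordValue = (wordCon s f).mk' := by
    refine FreeMonoid.hom_eq fun ⟨a, b⟩ => ?_
    simp only [wordValue, MonoidHom.comp_apply, FreeMonoid.lift_eval_of, map_mul,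
      Coprod.lift_apply_inl, Coprod.lift_apply_inr]
    refine (Con.eq _).2 fun χ C hC => ?_
    rw [hcomm, hcomm C]
    have := WordBound.merge_left_iff (s := s) (f := f) (D := C) (χ := χ) a 1 b
    rw [mul_one] at this
    exact this
  have := congrArg (Coprod.lift φ ψ) h
  rw [← MonoidHom.comp_apply, ← MonoidHom.comp_apply, hlift] at this
  exact (Con.eq _).1 this

/-- `WordBound` depends only on the conjugacy class of the value of the word. -/
theorem WordBound.of_conj {s : Perm Z} {f : Z → A × B} {D E : List (A × B)} {χ : ℤ}
    (hD : D ≠ []) (hE : E ≠ []) (x : Coprod A B)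
    (hx : wordValue (FreeMonoid.ofList E) = x * wordValue (FreeMonoid.ofList D) * x⁻¹)
    (h : WordBound s f D χ) : WordBound s f E χ := by
  obtain ⟨U, hU, hUx⟩ := exists_wordValue_eq x
  obtain ⟨V, hV, hVx⟩ := exists_wordValue_eq x⁻¹
  have hval : ∀ {D E : List (A × B)}, D ≠ [] → E ≠ [] →
      wordValue (FreeMonoid.ofList D) = wordValue (FreeMonoid.ofList E) →
      WordBound s f D χ → WordBound s f E χ := by
    intro D E hD hE hDE h
    rw [← merge_one_iff hD] at h
    rw [← merge_one_iff hE]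
    exact (wordCon_of_wordValue_eq s f hDE χ [(1, 1)] (by simp)).1 h
  have h1 : WordBound s f ((D ++ V) ++ U) χ := hval hD (by simp [hD]) (by simp [hUx, hVx]) h
  exact hval (by simp [hU]) hE (by simp [hx, hUx, hVx, mul_assoc]) h1.append_comm

/-- Each conjugate but the last is cut off as a new boundary curve reading `W`, at a cost of one;
the last remains as the distinguished word. -/
theorem exists_wordBound_of_prod_conj {W : List (A × B)} (hW : W ≠ [])
    (xs : List (Coprod A B)) (x : Coprod A B) : ∀ {Z : Type} [Fintype Z] {s : Perm Z}
    {f : Z → A × B} {D : List (A × B)} {χ : ℤ} {k : ℕ}, D ≠ [] → IsCopies W s f k →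
    wordValue (FreeMonoid.ofList D) =
      ((x :: xs).map fun x => x * wordValue (FreeMonoid.ofList W) * x⁻¹).prod →
    WordBound s f D χ → ∃ (Z' : Type) (_ : Fintype Z') (s' : Perm Z') (f' : Z' → A × B),
      IsCopies W s' f' (k + xs.length) ∧ WordBound s' f' W (χ - xs.length) := by
  induction xs generalizing x with
  | nil =>
    intro Z _ s f D χ k hD hk hval h
    refine ⟨Z, _, s, f, hk, ?_⟩
    simpa using h.of_conj hD hW x⁻¹ (by simp [hval, mul_assoc])
  | cons y ys ih =>
    intro Z _ s f D χ k hD hk hval h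
    obtain ⟨E, hE, hEval⟩ := exists_wordValue_eq
      (x⁻¹ * ((y :: ys).map fun x => x * wordValue (FreeMonoid.ofList W) * x⁻¹).prod * x)
    obtain ⟨E', hE', hEval'⟩ := exists_wordValue_eq
      ((y :: ys).map fun x => x * wordValue (FreeMonoid.ofList W) * x⁻¹).prod
    -- Conjugation by `x⁻¹` turns the first factor into `W` itself and the remaining product into
    -- its conjugate `E`.
    have h1 : WordBound s f (W ++ E) χ := h.of_conj hD (by simp [hW]) x⁻¹ (by
      rw [FreeMonoid.ofList_append, map_mul, hEval, hval, List.map_cons (a := x), List.prod_cons]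
      simp only [mul_assoc, inv_mul_cancel_left, inv_inv])
    have h2 := (h1.split W hW hE).of_conj hE hE' x (by rw [hEval, hEval']; group)
    obtain ⟨Z', i, s', f', h3, h4⟩ := ih y hE' (hk.succ hW) hEval' h2
    refine ⟨Z', i, s', f', ?_, ?_⟩
    · convert h3 using 1
      simp only [List.length_cons]; omega
    · convert h4 using 1
      push_cast [List.length_cons]; omega

theorem not_isGenTorsion_wordValue (hA : TorsionFreeGroup A) (hB : TorsionFreeGroup B)
    {W : List (A × B)} (hW : W ≠ []) (hW1 : ∀ p ∈ W, p.1 ≠ 1 ∧ p.2 ≠ 1) :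
    ¬ IsGenTorsion (wordValue (FreeMonoid.ofList W)) := by
  rintro ⟨n, hn, x, hx⟩
  obtain ⟨n, rfl⟩ := Nat.exists_eq_succ_of_ne_zero hn.ne'
  -- A disc with trivial boundary: one `A`-disc and one `B`-disc glued along one arc.
  have hstart : WordBound (1 : Perm Empty) Empty.elim [((1 : A), (1 : B))] 1 := by
    have h1 : ∀ x, Sum.elim [((1 : A), (1 : B))].get Empty.elim x = 1 := by
      rintro (i | z)
      · simp
      · exact z.elim
    exact ⟨1, 1, 1, ⟨fun _ => 0, 1, {0}, by simp, by simp, by simp [h1], le_rfl⟩,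
      ⟨fun _ => 0, 1, {0}, by simp, by simp, by simp [h1], le_rfl⟩, by simp⟩
  obtain ⟨Z, _, s, f, h1, h2⟩ := exists_wordBound_of_prod_conj hW
    (List.ofFn fun i : Fin n => x i.succ) (x 0) (k := 0) (by simp)
    ⟨fun z => z.elim, fun z => z.elim, fun z => z.elim, by simp⟩
    (by rw [← List.ofFn_succ, List.map_ofFn]; simp [wordValue, ← hx, Function.comp_def]) hstart
  -- Here `n` is one less than the number of conjugates, so the bound reads `1 - n ≤ -(n + 1)`.
  have := EulerBound.le_of_isCopies hA hB hW1 (h1.succ hW) h2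
  simp only [List.length_ofFn] at this
  push_cast at this
  omega

theorem wordValue_append_isConj (D E : List (A × B)) :
    IsConj (wordValue (FreeMonoid.ofList (D ++ E))) (wordValue (FreeMonoid.ofList (E ++ D))) := by
  rw [isConj_iff]
  exact ⟨(wordValue (FreeMonoid.ofList D))⁻¹, by simp⟩

/-- A letter with a trivial coordinate is rotated to the front and absorbed into a cyclic neighbour,
shortening the word. If it has no neighbour, the word lies in a factor. -/
theorem isConj_factor_or_reduced (n : ℕ) : ∀ D : List (A × B), D.length = n →
    (∃ a : A, IsConj (Coprod.inl a) (wordValue (FreeMonoid.ofList D))) ∨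
    (∃ b : B, IsConj (Coprod.inr b) (wordValue (FreeMonoid.ofList D))) ∨
    ∃ W : List (A × B), W ≠ [] ∧ (∀ p ∈ W, p.1 ≠ 1 ∧ p.2 ≠ 1) ∧
      IsConj (wordValue (FreeMonoid.ofList W)) (wordValue (FreeMonoid.ofList D)) := by
  induction n using Nat.strong_induction_on with
  | _ n ih =>
  intro D hn
  have step : ∀ E : List (A × B), E.length < n →
      IsConj (wordValue (FreeMonoid.ofList E)) (wordValue (FreeMonoid.ofList D)) →
      (∃ a : A, IsConj (Coprod.inl a) (wordValue (FreeMonoid.ofList D))) ∨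
      (∃ b : B, IsConj (Coprod.inr b) (wordValue (FreeMonoid.ofList D))) ∨
      ∃ W : List (A × B), W ≠ [] ∧ (∀ p ∈ W, p.1 ≠ 1 ∧ p.2 ≠ 1) ∧
        IsConj (wordValue (FreeMonoid.ofList W)) (wordValue (FreeMonoid.ofList D)) := by
    intro E hE hc
    rcases ih _ hE E rfl with ⟨a, ha⟩ | ⟨b, hb⟩ | ⟨W, h1, h2, h3⟩
    · exact Or.inl ⟨a, ha.trans hc⟩
    · exact Or.inr (Or.inl ⟨b, hb.trans hc⟩)
    · exact Or.inr (Or.inr ⟨W, h1, h2, h3.trans hc⟩)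
  by_cases hD : D = []
  · subst hD
    exact Or.inl ⟨1, by simp⟩
  by_cases hred : ∀ p ∈ D, p.1 ≠ 1 ∧ p.2 ≠ 1
  · exact Or.inr (Or.inr ⟨D, hD, hred, IsConj.refl _⟩)
  push Not at hred
  obtain ⟨⟨a, b⟩, hp, hab⟩ := hred
  obtain ⟨C, E, rfl⟩ := List.append_of_mem hp
  have hconj := wordValue_append_isConj ((a, b) :: E) C
  rw [List.cons_append] at hconj
  simp only [List.length_append, List.length_cons] at hn
  have hlen : (E ++ C).length + 1 = n := by simp; omega
  generalize E ++ C = F at hconj hlen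
  by_cases ha : a = 1
  · subst ha
    rcases F.eq_nil_or_concat with rfl | ⟨F, ⟨x, y⟩, rfl⟩
    · exact Or.inr (Or.inl ⟨b, by simpa [wordValue] using hconj⟩)
    · refine step ((x, y * b) :: F) (by simp at hlen ⊢; omega) (IsConj.trans ?_ hconj)
      have := wordValue_append_isConj [(x, y)] ((1, b) :: F)
      simpa [wordValue, FreeMonoid.ofList_cons, mul_assoc] using this
  · obtain rfl : b = 1 := hab ha
    rcases F with _ | ⟨⟨x, y⟩, F⟩
    · exact Or.inl ⟨a, by simpa [wordValue] using hconj⟩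
    · refine step ((a * x, y) :: F) (by simp at hlen ⊢; omega) (IsConj.trans ?_ hconj)
      rw [show wordValue (FreeMonoid.ofList ((a * x, y) :: F)) =
        wordValue (FreeMonoid.ofList ((a, 1) :: (x, y) :: F)) by
          simp [wordValue, FreeMonoid.ofList_cons, mul_assoc]]

/-- Every element of a free product is conjugate into a factor or to a cyclically reduced word
of positive length. -/
theorem exists_conj_reduced (g : Coprod A B) : (∃ a : A, IsConj (Coprod.inl a) g) ∨
    (∃ b : B, IsConj (Coprod.inr b) g) ∨ ∃ W : List (A × B), W ≠ [] ∧
      (∀ p ∈ W, p.1 ≠ 1 ∧ p.2 ≠ 1) ∧ IsConj (wordValue (FreeMonoid.ofList W)) g := by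
  obtain ⟨D, -, rfl⟩ := exists_wordValue_eq g
  exact isConj_factor_or_reduced _ D rfl

end Value

/-! ### Spectra under conjugation and retraction; the theorem. -/

theorem genTorsionEqSpectrum_conj {G : Type*} [Group G] {g k : G} (h : IsConj g k) :
    genTorsionEqSpectrum g = genTorsionEqSpectrum k := by
  have key : ∀ {g k : G}, IsConj g k → genTorsionEqSpectrum k ⊆ genTorsionEqSpectrum g := by
    rintro g k h n ⟨hn, x, hx⟩
    obtain ⟨c, rfl⟩ := isConj_iff.1 h
    refine ⟨hn, fun i => x i * c, ?_⟩
    rw [← hx]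
    simp [mul_assoc]
  exact (key h.symm).antisymm (key h)

theorem genTorsionEqSpectrum_map_subset {G K : Type*} [Group G] [Group K] (φ : G →* K) (g : G) :
    genTorsionEqSpectrum g ⊆ genTorsionEqSpectrum (φ g) := by
  rintro n ⟨hn, x, hx⟩
  refine ⟨hn, φ ∘ x, ?_⟩
  have := congrArg φ hx
  rw [map_list_prod, List.map_ofFn, map_one] at this
  simpa [Function.comp_def] using this

theorem genTorsionEqSpectrum_of_retraction {G K : Type*} [Group G] [Group K] (φ : G →* K)
    (ρ : K →* G) (h : ∀ g, ρ (φ g) = g) (g : G) :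
    genTorsionEqSpectrum (φ g) = genTorsionEqSpectrum g := by
  refine (Set.Subset.trans (genTorsionEqSpectrum_map_subset ρ _) ?_).antisymm
    (genTorsionEqSpectrum_map_subset φ g)
  rw [h]

theorem IsConj.isOfFinOrder_iff {G : Type*} [Group G] {g k : G} (h : IsConj g k) :
    IsOfFinOrder g ↔ IsOfFinOrder k := by
  obtain ⟨c, rfl⟩ := isConj_iff.1 h
  exact ((MulAut.conj c).injective.isOfFinOrder_iff (f := (MulAut.conj c).toMonoidHom)).symm

theorem mem_strictGordSpectrum_of_isConj {G K : Type*} [Group G] [Group K] (φ : G →* K)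
    (ρ : K →* G) (h : ∀ g, ρ (φ g) = g) {g : G} {k : K} (hk : IsConj (φ g) k)
    (hk1 : ¬ IsOfFinOrder k) (hk2 : IsGenTorsion k) : gord k ∈ strictGordSpectrum G := by
  have := (genTorsionEqSpectrum_conj hk).symm.trans (genTorsionEqSpectrum_of_retraction φ ρ h g)
  refine ⟨g, fun hg => hk1 (hk.isOfFinOrder_iff.1 (φ.isOfFinOrder hg)), ?_, ?_⟩
  · rwa [IsGenTorsion, ← this]
  · rw [gord, gord, this]

theorem strictGordSpectrum_subset_of_retraction {G K : Type*} [Group G] [Group K] (φ : G →* K)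
    (ρ : K →* G) (h : ∀ g, ρ (φ g) = g) : strictGordSpectrum G ⊆ strictGordSpectrum K := by
  rintro _ ⟨g, hg1, hg2, rfl⟩
  have := genTorsionEqSpectrum_of_retraction φ ρ h g
  refine ⟨φ g, fun hg => hg1 (h g ▸ ρ.isOfFinOrder hg), ?_, ?_⟩
  · rwa [IsGenTorsion, this]
  · rw [gord, gord, this]

theorem mainTheorem8 {G : Type*} {H : Type*} [Group G] [Group H]
    (hG : TorsionFreeGroup G) (hH : TorsionFreeGroup H) :
    strictGordSpectrum (Monoid.Coprod G H) = strictGordSpectrum G ∪ strictGordSpectrum H := by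
  refine Set.Subset.antisymm ?_ (Set.union_subset
    (strictGordSpectrum_subset_of_retraction Coprod.inl Coprod.fst (by simp))
    (strictGordSpectrum_subset_of_retraction Coprod.inr Coprod.snd (by simp)))
  rintro _ ⟨k, hk1, hk2, rfl⟩
  rcases exists_conj_reduced k with ⟨a, ha⟩ | ⟨b, hb⟩ | ⟨W, hW, hW1, hWk⟩
  · exact Or.inl (mem_strictGordSpectrum_of_isConj Coprod.inl Coprod.fst (by simp) ha hk1 hk2)
  · exact Or.inr (mem_strictGordSpectrum_of_isConj Coprod.inr Coprod.snd (by simp) hb hk1 hk2)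
  · refine absurd ?_ (not_isGenTorsion_wordValue hG hH hW hW1)
    rwa [IsGenTorsion, genTorsionEqSpectrum_conj hWk]
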